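/- For every integer $d\ge 2$ there exist $\epsilon=\epsilon(d)>0$ and $\eta=\eta(d)>0$, depending only on $d$, such that the following holds for every finite distance-regular graph $X$ of diameter $d$ on $n$ vertices. (Distance-regular means: $X$ is connected and for each $0\le i\le d$ there are constants $a_i,b_i,c_i$ such that, for all vertices $v,w$ at distance $i$, the vertex $w$ has exactly $a_i$, $b_i$, $c_i$ neighbours at distance $i$, $i+1$, $i-1$ from $v$, respectively; such an $X$ is regular.) Let $k$ be the degree of $X$, and let $k=\xi_1\ge\xi_2\ge\dots\ge\xi_n$ be the eigenvalues of its adjacency matrix, listed with multiplicity. 1. If $X$ has a $(1-\epsilon)$-dominant distance, that is, if for some $t\ge 1$ at least $(1-\epsilon)\binom n2$ of the $\binom n2$ unordered pairs of distinct vertices are at distance $t$, then $X$ is a spectral $\eta$-expander: $|\xi_i|\le (1-\eta)k$ for all $2\le i\le n$. 2. Likewise, if for some $1\le t\le d$ the number $k_t$ of vertices at distance $t$ from a vertex (which does not depend on the vertex) satisfies $k_t\ge(1-\epsilon)n$, then the zero-weight spectral radius $\xi=\max_{2\le i\le n}|\xi_i|$ satisfies $\xi\le(1-\eta)k$. -/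

import Mathlib

namespace SimpleGraph

variable {V : Type*}

/-- The set `N_i(v)` of the vertices at distance `i` from `v`. Meant for connected graphs
(Mathlib gives distance `0` to vertices in different components). -/
def distSphere (G : SimpleGraph V) (i : ℕ) (v : V) : Set V :=
  {w | G.dist v w = i}

/-- A connected graph of finite diameter `d` is distance-regular if for every `0 ≤ i ≤ d` there are
constants `a_i`, `b_i`, `c_i` such that every vertex `w ∈ N_i(v)` has exactly `a_i` neighbours in
`N_i(v)`, exactly `b_i` neighbours in `N_{i+1}(v)` and exactly `c_i` neighbours in `N_{i-1}(v)`
(the latter set being empty for `i = 0`). -/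
def IsDistanceRegular (G : SimpleGraph V) : Prop :=
  G.Connected ∧ G.ediam ≠ ⊤ ∧
    ∀ i ≤ G.diam, ∃ a b c : ℕ, ∀ v : V, ∀ w ∈ G.distSphere i v,
      {u | G.Adj w u ∧ G.dist v u = i}.ncard = a ∧
      {u | G.Adj w u ∧ G.dist v u = i + 1}.ncard = b ∧
      {u | G.Adj w u ∧ G.dist v u + 1 = i}.ncard = c

/-- The distance-`t` graph: two distinct vertices are joined if they are at distance `t`. -/
def distanceGraph (G : SimpleGraph V) (t : ℕ) : SimpleGraph V where
  Adj u v := u ≠ v ∧ G.dist u v = t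
  symm := ⟨fun _ _ h => ⟨h.1.symm, by rw [dist_comm]; exact h.2⟩⟩
  loopless := ⟨fun _ h => h.1 rfl⟩

/-- The distance `t ≥ 1` is `p`-dominant: of the `n.choose 2` unordered pairs of distinct vertices,
at least `p * n.choose 2` are at distance `t`. -/
def IsDominantDistance [Fintype V] (G : SimpleGraph V) (p : ℝ) (t : ℕ) : Prop :=
  1 ≤ t ∧ p * ((Fintype.card V).choose 2 : ℝ) ≤ ((G.distanceGraph t).edgeSet.ncard : ℝ)

/-- The eigenvalues `ξ_0 ≥ ξ_1 ≥ … ≥ ξ_{n-1}` of the adjacency matrix, in non-increasing order and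
listed with multiplicity. For a `k`-regular graph `ξ_0 = k` is the principal eigenvalue, and the
`ξ_i` with `i ≠ 0` are the non-principal ones. -/
noncomputable def adjEigenvalue [Fintype V] [DecidableEq V] (G : SimpleGraph V)
    [DecidableRel G.Adj] (i : Fin (Fintype.card V)) : ℝ :=
  (G.isHermitian_adjMatrix ℝ).eigenvalues₀ i

/-- A spectral `η`-expander: a graph that is `k`-regular for some `k` and whose non-principal
eigenvalues all have absolute value at most `k (1 - η)`. -/
def IsSpectralExpander [Fintype V] [DecidableEq V] (G : SimpleGraph V) [DecidableRel G.Adj]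
    (η : ℝ) : Prop :=
  ∃ k : ℕ, G.IsRegularOfDegree k ∧
    ∀ i : Fin (Fintype.card V), (i : ℕ) ≠ 0 → |G.adjEigenvalue i| ≤ k * (1 - η)

/-- The zero-weight spectral radius: the maximum of the absolute values of the non-principal
eigenvalues (of which there is at least one as soon as there are two vertices). -/
noncomputable def zeroWeightSpectralRadius [Fintype V] [DecidableEq V] (G : SimpleGraph V)
    [DecidableRel G.Adj] : ℝ :=
  ⨆ i : {i : Fin (Fintype.card V) // (i : ℕ) ≠ 0}, |G.adjEigenvalue i|

end SimpleGraph

/-!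
# Distance-regular graphs with a dominant distance are spectral expanders

Let `G` be distance-regular of diameter `d` and degree `k`, with intersection numbers `a i`, `b i`,
`c i` and spheres of size `K i`, and let all but a proportion `δ` of the vertices be at distance `t`
from any given one.

*Bounds for the intersection numbers.* Counting edges between consecutive spheres gives
`b i * K i = c (i + 1) * K (i + 1)`. Since `K t` is large and `c` is non-decreasing, `c i` is at
most about `δ k` for `i ≤ t`. Next, the number of common vertices of the spheres of radius `i` around
`u` and `w` depends only on the distance of `u` and `w`
(`SimpleGraph.HasIntersectionNumbers.dependsOnDist_mul_distMatrix`). For adjacent vertices it is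
`K i * a i / k`, so for vertices at distance `t` it is at least `K i * (1 - t * (1 - a i / k))`. On
the other hand it is at most `K i ^ 2 / K t` for vertices at distance `t`, by averaging. If `i ≠ t`,
then `K i` is much smaller than `K t`, and so `a i ≤ (1 - 1 / (2 d)) k`
(`SimpleGraph.HasIntersectionNumbers.mul_sphereCard_sub_le`).

*Eigenvalues.* Let `f` be an eigenvector with zero sum for the eigenvalue `θ`, normalised so that
its largest absolute value is `f v = 1`, and let `u i` be its average over the sphere of radius `i`
around `v`. Then `|u i| ≤ 1`, `u 0 = 1` and `(θ - a i) u i = c i * u (i - 1) + b i * u (i + 1)`, and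
`u t` is of order `δ` as `f` has zero sum. If `|θ| > (1 - 1 / (4 d)) k`, then
`|θ - a i| ≥ k / (4 d)` for `i < t`, and as `c i` is small the recurrence propagates the smallness
of `u t` inwards to `u (t - 1)`, …, `u 0`: it gives `1 ≤ (8 d) ^ d * δ`, which is false for small `δ`
(`SimpleGraph.HasIntersectionNumbers.abs_eigenvalue_le`).
-/

/-! ### Non-principal eigenvalues of a matrix with constant row sums -/

section

open Matrix

/-- A real symmetric matrix with constant row sums `k` has at most one eigenvalue, counted with
multiplicity, that is not witnessed by an eigenvector with zero coordinate sum. If the eigenvalues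
with such eigenvectors are bounded by `M < k`, this exceptional one is the largest. -/
lemma Matrix.IsHermitian.abs_eigenvalues₀_le_of_sum_eq_zero {V : Type*} [Fintype V]
    [DecidableEq V] {A : Matrix V V ℝ} (hA : A.IsHermitian) {k M : ℝ} (hM : M < k)
    (hrow : A *ᵥ (fun _ => 1) = fun _ => k)
    (h : ∀ (f : V → ℝ) (θ : ℝ), f ≠ 0 → ∑ v, f v = 0 → A *ᵥ f = θ • f → |θ| ≤ M)
    (i : Fin (Fintype.card V)) (hi : (i : ℕ) ≠ 0) : |hA.eigenvalues₀ i| ≤ M := by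
  set e : Fin (Fintype.card V) ≃ V := Fintype.equivOfCardEq (Fintype.card_fin _) with he
  have hval (j) : hA.eigenvalues (e j) = hA.eigenvalues₀ j := by
    simp [Matrix.IsHermitian.eigenvalues, he]
  have hvec (j) : A *ᵥ ⇑(hA.eigenvectorBasis (e j)) =
      hA.eigenvalues₀ j • ⇑(hA.eigenvectorBasis (e j)) := by
    rw [hA.mulVec_eigenvectorBasis, hval]
  have hne (j) : ⇑(hA.eigenvectorBasis (e j)) ≠ 0 := by
    intro h0
    apply hA.eigenvectorBasis.orthonormal.ne_zero (e j)
    ext x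
    exact congrFun h0 x
  -- an eigenvector that is not orthogonal to the all-ones vector has eigenvalue `k`
  have hk (j) (hj : ∑ v, hA.eigenvectorBasis (e j) v ≠ 0) : hA.eigenvalues₀ j = k := by
    set f : V → ℝ := ⇑(hA.eigenvectorBasis (e j))
    have h1 : (fun _ => 1) ⬝ᵥ (A *ᵥ f) = (A *ᵥ (fun _ => 1)) ⬝ᵥ f := by
      have hT : Aᵀ = A := by simpa using hA.eq
      rw [Matrix.dotProduct_mulVec, ← Matrix.mulVec_transpose, hT]
    rw [hvec, hrow] at h1
    simp only [dotProduct, Pi.smul_apply, smul_eq_mul, one_mul, ← Finset.mul_sum] at h1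
    exact mul_right_cancel₀ hj h1
  by_cases hsi : ∑ v, hA.eigenvectorBasis (e i) v = 0
  · exact h _ _ (hne i) hsi (hvec i)
  exfalso
  have hki := hk i hsi
  set z : Fin (Fintype.card V) := ⟨0, by have := i.2; omega⟩ with hz
  have hzi : z ≤ i := Nat.zero_le _
  have hk0 : hA.eigenvalues₀ z = k := by
    by_contra hcon
    have h0 : ∑ v, hA.eigenvectorBasis (e z) v = 0 := by
      by_contra h0
      exact hcon (hk z h0)
    have := h _ _ (hne z) h0 (hvec z)
    have := hA.eigenvalues₀_antitone hzi
    have := le_abs_self (hA.eigenvalues₀ z)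
    linarith
  -- two independent eigenvectors for `k` combine to one with zero sum
  set s := ∑ v, hA.eigenvectorBasis (e i) v
  set s' := ∑ v, hA.eigenvectorBasis (e z) v
  have := h (s • ⇑(hA.eigenvectorBasis (e z)) - s' • ⇑(hA.eigenvectorBasis (e i))) k ?_ ?_ ?_
  · have := le_abs_self k
    linarith
  · intro h0
    have h1 : s • hA.eigenvectorBasis (e z) - s' • hA.eigenvectorBasis (e i) = 0 := by
      ext x
      exact congrFun h0 x
    have hzi' : e z ≠ e i := by
      intro h
      have := e.injective h
      exact hi (by rw [← this])
    have h2 := congrArg (fun y => inner ℝ (hA.eigenvectorBasis (e z)) y) h1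
    simp only [inner_sub_right, inner_smul_right, inner_zero_right,
      hA.eigenvectorBasis.orthonormal.2 hzi', real_inner_self_eq_norm_sq,
      hA.eigenvectorBasis.orthonormal.1] at h2
    apply hsi
    linarith
  · simp only [Pi.sub_apply, Pi.smul_apply, smul_eq_mul, Finset.sum_sub_distrib, ← Finset.mul_sum]
    change s * s' - s' * s = 0
    ring
  · rw [Matrix.mulVec_sub, Matrix.mulVec_smul, Matrix.mulVec_smul, hvec, hvec, hki, hk0, smul_sub,
      smul_comm k, smul_comm k]

end

namespace SimpleGraph

open Finset Matrix

/-! ### Geodesics and distance matrices -/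

variable {V : Type*} {G : SimpleGraph V}

/-- A vertex `i + 1` steps from `v` has a neighbour `i` steps from `v`. -/
lemma Connected.exists_adj_dist_eq (hG : G.Connected) {v w : V} {i : ℕ}
    (h : G.dist v w = i + 1) : ∃ x, G.Adj x w ∧ G.dist v x = i := by
  obtain ⟨p, hp⟩ := hG.exists_walk_length_eq_dist w v
  rw [dist_comm, h] at hp
  cases p with
  | nil => simp at hp
  | @cons _ x _ hwx q =>
    refine ⟨x, hwx.symm, ?_⟩
    have h1 := G.dist_le q
    have h2 := hG.dist_triangle (u := v) (v := x) (w := w)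
    rw [dist_eq_one_iff_adj.2 hwx.symm] at h2
    rw [Walk.length_cons] at hp
    rw [dist_comm] at h1
    omega

/-- A geodesic from `v` to `w` has vertices at all distances `i ≤ dist v w` from `w`. -/
lemma Connected.exists_dist_add_dist_eq (hG : G.Connected) {v w : V} {i : ℕ}
    (h : i ≤ G.dist v w) : ∃ x, G.dist x w = i ∧ G.dist v x + i = G.dist v w := by
  induction i with
  | zero => exact ⟨w, by simp⟩
  | succ i ih =>
    obtain ⟨x, hx, hx'⟩ := ih (by omega)
    obtain ⟨y, hy, hy'⟩ := hG.exists_adj_dist_eq (v := v) (w := x) (i := G.dist v w - i - 1)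
      (by omega)
    refine ⟨y, ?_, by omega⟩
    have h1 := hG.dist_triangle (u := v) (v := y) (w := w)
    have h2 := hG.dist_triangle (u := y) (v := x) (w := w)
    rw [dist_eq_one_iff_adj.2 hy] at h2
    omega

/-- The distance-`i` matrix: the indicator of the pairs of vertices at distance `i`. -/
noncomputable def distMatrix (G : SimpleGraph V) (i : ℕ) : Matrix V V ℝ :=
  Matrix.of fun u w => if G.dist u w = i then 1 else 0

lemma distMatrix_apply (i : ℕ) (u w : V) :
    G.distMatrix i u w = if G.dist u w = i then 1 else 0 := rfl

lemma distMatrix_apply_comm (i : ℕ) (u w : V) : G.distMatrix i u w = G.distMatrix i w u := by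
  simp [distMatrix_apply, dist_comm]

lemma distMatrix_nonneg (i : ℕ) (u w : V) : 0 ≤ G.distMatrix i u w := by
  rw [distMatrix_apply]; positivity

lemma Connected.distMatrix_zero [DecidableEq V] (hG : G.Connected) : G.distMatrix 0 = 1 := by
  ext u w
  simp [distMatrix_apply, Matrix.one_apply, hG.dist_eq_zero_iff]

/-- The matrices whose entry at `(u, w)` depends only on the distance of `u` and `w`. -/
def DependsOnDist (G : SimpleGraph V) (M : Matrix V V ℝ) : Prop :=
  ∃ f : ℕ → ℝ, ∀ u w, M u w = f (G.dist u w)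

lemma dependsOnDist_distMatrix (i : ℕ) : G.DependsOnDist (G.distMatrix i) :=
  ⟨fun j => if j = i then 1 else 0, fun _ _ => rfl⟩

lemma DependsOnDist.sub_smul {M N : Matrix V V ℝ} (x : ℝ) (hM : G.DependsOnDist M)
    (hN : G.DependsOnDist N) : G.DependsOnDist (M - x • N) := by
  obtain ⟨f, hf⟩ := hM
  obtain ⟨g, hg⟩ := hN
  exact ⟨fun j => f j - x * g j, fun u w => by simp [hf, hg]⟩

variable [Fintype V]

/-! ### Sums over spheres

Throughout, `K i` is the common number of vertices in a sphere of radius `i`, given as a row sum of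
the distance-`i` matrix. -/

section

variable {K : ℕ → ℝ} (hK : ∀ i v, ∑ w, G.distMatrix i v w = K i)
include hK

lemma sphereCard_eq_card (i : ℕ) (v : V) : K i = #{w | G.dist v w = i} := by
  rw [← hK i v]
  simp [distMatrix_apply]

lemma sphereCard_nonneg [Nonempty V] (i : ℕ) : 0 ≤ K i := by
  rw [sphereCard_eq_card hK i (Classical.arbitrary V)]
  positivity

lemma one_le_sphereCard {v w : V} {i : ℕ} (hi : G.dist v w = i) : 1 ≤ K i := by
  rw [sphereCard_eq_card hK i v]
  exact_mod_cast Finset.card_pos.2 ⟨w, by simpa using hi⟩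

lemma sum_sphereCard_le [Nonempty V] (s : Finset ℕ) : ∑ i ∈ s, K i ≤ Fintype.card V := by
  obtain ⟨v⟩ := ‹Nonempty V›
  simp only [← hK _ v]
  rw [Finset.sum_comm, Fintype.card, Finset.cast_card]
  refine Finset.sum_le_sum fun w _ => ?_
  simp only [distMatrix_apply, Finset.sum_ite_eq]
  split_ifs <;> norm_num

lemma abs_distMatrix_mulVec_le {f : V → ℝ} {m : ℝ} (hf : ∀ w, |f w| ≤ m) (i : ℕ) (v : V) :
    |(G.distMatrix i *ᵥ f) v| ≤ K i * m := by
  rw [← hK i v, Finset.sum_mul]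
  refine (Finset.abs_sum_le_sum_abs _ _).trans (Finset.sum_le_sum fun w _ => ?_)
  rw [abs_mul, abs_of_nonneg (distMatrix_nonneg ..)]
  exact mul_le_mul_of_nonneg_left (hf w) (distMatrix_nonneg ..)

/-- A function with zero sum has a small sum over a sphere that contains most vertices. -/
lemma abs_distMatrix_mulVec_le_of_sum_eq_zero {f : V → ℝ} {m : ℝ} (hf : ∀ w, |f w| ≤ m)
    (hsum : ∑ w, f w = 0) (i : ℕ) (v : V) :
    |(G.distMatrix i *ᵥ f) v| ≤ (Fintype.card V - K i) * m := by
  have h1 : (G.distMatrix i *ᵥ f) v = -∑ w, (1 - G.distMatrix i v w) * f w := by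
    simp only [sub_mul, one_mul, Finset.sum_sub_distrib, hsum, zero_sub, neg_neg]
    rfl
  rw [h1, abs_neg, ← hK i v, Fintype.card, Finset.cast_card, ← Finset.sum_sub_distrib,
    Finset.sum_mul]
  refine (Finset.abs_sum_le_sum_abs _ _).trans (Finset.sum_le_sum fun w _ => ?_)
  have h2 : 0 ≤ 1 - G.distMatrix i v w := by
    rw [distMatrix_apply]
    split_ifs <;> norm_num
  rw [abs_mul, abs_of_nonneg h2]
  exact mul_le_mul_of_nonneg_left (hf w) h2

end

/-! ### Intersection numbers -/

variable [DecidableRel G.Adj]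

/-- The connected graph `G` has intersection numbers `a i`, `b i`, `c i`: of the neighbours of a
vertex `w` at distance `i` from `v`, exactly `a i`, `b i`, `c i` are at distance `i`, `i + 1`,
`i - 1` from `v`. The values at an `i` that is not a distance of `G` are unconstrained. -/
structure HasIntersectionNumbers (G : SimpleGraph V) [DecidableRel G.Adj] (a b c : ℕ → ℕ) :
    Prop where
  connected : G.Connected
  card_same : ∀ v w, #{u ∈ G.neighborFinset w | G.dist v u = G.dist v w} = a (G.dist v w)
  card_succ : ∀ v w, #{u ∈ G.neighborFinset w | G.dist v u = G.dist v w + 1} = b (G.dist v w)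
  card_pred : ∀ v w, #{u ∈ G.neighborFinset w | G.dist v u + 1 = G.dist v w} = c (G.dist v w)

lemma IsDistanceRegular.exists_hasIntersectionNumbers (h : G.IsDistanceRegular) :
    ∃ a b c : ℕ → ℕ, G.HasIntersectionNumbers a b c := by
  obtain ⟨hconn, hdiam, hreg⟩ := h
  choose! a b c habc using hreg
  have hset (w : V) (p : V → Prop) [DecidablePred p] :
      #{u ∈ G.neighborFinset w | p u} = {u | G.Adj w u ∧ p u}.ncard := by
    rw [← Set.ncard_coe_finset]
    congr 1
    ext u
    simp
  refine ⟨a, b, c, hconn, fun v w => ?_, fun v w => ?_, fun v w => ?_⟩ <;> rw [hset]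
  · exact (habc _ (dist_le_diam hdiam) v w rfl).1
  · exact (habc _ (dist_le_diam hdiam) v w rfl).2.1
  · exact (habc _ (dist_le_diam hdiam) v w rfl).2.2

namespace HasIntersectionNumbers

variable {a b c : ℕ → ℕ} (h : G.HasIntersectionNumbers a b c)
include h

lemma sum_neighborFinset_dist (g : ℕ → ℝ) (v w : V) :
    ∑ x ∈ G.neighborFinset w, g (G.dist v x) =
      c (G.dist v w) * g (G.dist v w - 1) + a (G.dist v w) * g (G.dist v w) +
        b (G.dist v w) * g (G.dist v w + 1) := by
  rw [← h.card_same v w, ← h.card_succ v w, ← h.card_pred v w]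
  simp only [← nsmul_eq_mul, ← Finset.sum_const, Finset.sum_filter, ← Finset.sum_add_distrib]
  refine Finset.sum_congr rfl fun x hx => ?_
  rcases Adj.diff_dist_adj (u := v) ((G.mem_neighborFinset _ _).1 hx) with h1 | h1 | h1
  · simp [h1]
  · rw [if_neg (by omega), if_neg (by omega), if_pos h1, h1]
    ring
  · rcases Nat.eq_zero_or_pos (G.dist v w) with h0 | h0
    · simp [h1, h0]
    · rw [if_pos (by omega), if_neg (by omega), if_neg (by omega), h1]
      ring

lemma c_zero : c 0 = 0 := by
  obtain ⟨v⟩ := h.connected.nonempty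
  simpa using (h.card_pred v v).symm

lemma a_zero : a 0 = 0 := by
  obtain ⟨v⟩ := h.connected.nonempty
  have := h.card_same v v
  rw [dist_self] at this
  rw [← this, Finset.card_eq_zero, Finset.filter_eq_empty_iff]
  intro x hx h0
  rw [h.connected.dist_eq_zero_iff] at h0
  subst h0
  simp at hx

lemma isRegularOfDegree : G.IsRegularOfDegree (b 0) := by
  intro v
  have := h.card_succ v v
  rw [dist_self] at this
  rw [← this, ← card_neighborFinset_eq_degree, Finset.filter_true_of_mem]
  intro x hx
  simpa [dist_eq_one_iff_adj] using hx

lemma b_le (v w : V) : b (G.dist v w) ≤ b 0 := by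
  rw [← h.card_succ, ← h.isRegularOfDegree w, ← card_neighborFinset_eq_degree]
  exact Finset.card_filter_le _ _

lemma c_pos {v w : V} {i : ℕ} (hi : G.dist v w = i + 1) : 0 < c (i + 1) := by
  obtain ⟨x, hx, hx'⟩ := h.connected.exists_adj_dist_eq hi
  rw [← hi, ← h.card_pred, Finset.card_pos]
  exact ⟨x, by simp [hx.symm, hx', hi]⟩

/-- The numbers `c i` are non-decreasing up to the diameter. -/
lemma c_le {v w : V} {i : ℕ} (hi : i ≤ G.dist v w) : c i ≤ c (G.dist v w) := by
  obtain ⟨x, hx, hx'⟩ := h.connected.exists_dist_add_dist_eq hi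
  rw [← h.card_pred v w, ← hx, ← h.card_pred x w]
  refine Finset.card_le_card fun u hu => ?_
  rw [Finset.mem_filter] at hu ⊢
  refine ⟨hu.1, ?_⟩
  have h1 := h.connected.dist_triangle (u := v) (v := x) (w := u)
  have h2 := h.connected.dist_triangle (u := v) (v := u) (w := w)
  rw [dist_eq_one_iff_adj.2 ((G.mem_neighborFinset _ _).1 hu.1).symm] at h2
  omega

lemma dependsOnDist_mul_adjMatrix {M : Matrix V V ℝ} (hM : G.DependsOnDist M) :
    G.DependsOnDist (M * G.adjMatrix ℝ) := by
  obtain ⟨f, hf⟩ := hM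
  refine ⟨fun j => c j * f (j - 1) + a j * f j + b j * f (j + 1), fun u w => ?_⟩
  simp only [mul_adjMatrix_apply, ← h.sum_neighborFinset_dist, hf]

lemma distMatrix_mul_adjMatrix_apply (i : ℕ) (u w : V) :
    (G.distMatrix i * G.adjMatrix ℝ) u w =
      (if G.dist u w = i + 1 then (c (i + 1) : ℝ) else 0) +
        (if G.dist u w = i then (a i : ℝ) else 0) +
          (if G.dist u w + 1 = i then (b (G.dist u w) : ℝ) else 0) := by
  rw [mul_adjMatrix_apply]
  simp only [distMatrix_apply]
  rw [h.sum_neighborFinset_dist (fun j => if j = i then 1 else 0)]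
  generalize G.dist u w = j
  rcases j with _ | j
  · rcases i with _ | i
    · simp [h.c_zero]
    · by_cases h1 : i = 0 <;> simp [h1, h.c_zero, eq_comm]
  · by_cases h1 : j = i
    · subst h1; simp
    · by_cases h2 : j + 1 = i
      · subst h2; simp
      · by_cases h3 : j + 1 + 1 = i
        · subst h3; simp [show j ≠ j + 1 + 1 by omega]
        · simp [h1, h2, h3]

lemma distMatrix_succ_mul_adjMatrix (i : ℕ) :
    G.distMatrix (i + 1) * G.adjMatrix ℝ = (b i : ℝ) • G.distMatrix i +
      (a (i + 1) : ℝ) • G.distMatrix (i + 1) + (c (i + 2) : ℝ) • G.distMatrix (i + 2) := by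
  ext u w
  rw [h.distMatrix_mul_adjMatrix_apply]
  simp only [Matrix.add_apply, Matrix.smul_apply, distMatrix_apply, smul_eq_mul]
  by_cases h1 : G.dist u w = i
  · simp [h1, show i ≠ i + 1 + 1 by omega]
  · by_cases h2 : G.dist u w = i + 1
    · simp [h2]
    · by_cases h3 : G.dist u w = i + 2
      · simp [h3]
      · simp [h1, h2, h3]

lemma distMatrix_zero_mul_adjMatrix :
    G.distMatrix 0 * G.adjMatrix ℝ = (c 1 : ℝ) • G.distMatrix 1 := by
  ext u w
  rw [h.distMatrix_mul_adjMatrix_apply]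
  simp [distMatrix_apply, h.a_zero]

/-- The matrices that depend only on the distance are closed under multiplication by distance
matrices, so the number of vertices at distances `i` and `j` from `u` and `w` depends only on `i`,
`j` and the distance of `u` and `w`. -/
lemma dependsOnDist_mul_distMatrix {M : Matrix V V ℝ} (hM : G.DependsOnDist M) (i : ℕ) :
    G.DependsOnDist (M * G.distMatrix i) := by
  classical
  have key (j : ℕ) (hj : G.DependsOnDist ((c (j + 1) : ℝ) • (M * G.distMatrix (j + 1)))) :
      G.DependsOnDist (M * G.distMatrix (j + 1)) := by
    by_cases hc : c (j + 1) = 0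
    · have h0 : G.distMatrix (j + 1) = 0 := by
        ext u w
        rw [distMatrix_apply, if_neg, Matrix.zero_apply]
        intro huw
        exact (h.c_pos huw).ne' hc
      exact ⟨0, by simp [h0]⟩
    · obtain ⟨f, hf⟩ := hj
      refine ⟨fun l => (c (j + 1) : ℝ)⁻¹ * f l, fun u w => ?_⟩
      have hc' : (c (j + 1) : ℝ) ≠ 0 := by exact_mod_cast hc
      simp only [← hf, Matrix.smul_apply, smul_eq_mul, inv_mul_cancel_left₀ hc']
  induction i using Nat.twoStepInduction with
  | zero => rwa [h.connected.distMatrix_zero, Matrix.mul_one]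
  | one =>
    apply key
    rw [← Matrix.mul_smul, ← h.distMatrix_zero_mul_adjMatrix, h.connected.distMatrix_zero,
      Matrix.one_mul]
    exact h.dependsOnDist_mul_adjMatrix hM
  | more i ih ih' =>
    apply key
    have h1 := h.distMatrix_succ_mul_adjMatrix i
    have h2 : (c (i + 1 + 1) : ℝ) • (M * G.distMatrix (i + 1 + 1)) =
        (M * G.distMatrix (i + 1)) * G.adjMatrix ℝ - (b i : ℝ) • (M * G.distMatrix i) -
          (a (i + 1) : ℝ) • (M * G.distMatrix (i + 1)) := by
      rw [Matrix.mul_assoc, h1]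
      simp only [Matrix.mul_add, Matrix.mul_smul]
      abel
    rw [h2]
    exact DependsOnDist.sub_smul _
      (DependsOnDist.sub_smul _ (h.dependsOnDist_mul_adjMatrix ih') ih) ih'

/-! ### Sphere sizes -/

lemma degree_pos {v w : V} (hvw : G.dist v w = 1) : 0 < b 0 := by
  have h1 := h.isRegularOfDegree v
  rw [← h1, degree_pos_iff_exists_adj]
  exact ⟨w, dist_eq_one_iff_adj.1 hvw⟩

lemma exists_sphereCard : ∃ K : ℕ → ℝ, ∀ i v, ∑ w, G.distMatrix i v w = K i := by
  have hdep (i : ℕ) := h.dependsOnDist_mul_distMatrix (dependsOnDist_distMatrix (G := G) i) i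
  choose f hf using hdep
  refine ⟨fun i => f i 0, fun i v => ?_⟩
  have h1 := hf i v v
  rw [dist_self] at h1
  refine Eq.trans ?_ h1
  rw [Matrix.mul_apply]
  refine Finset.sum_congr rfl fun w _ => ?_
  rw [distMatrix_apply_comm i w v, distMatrix_apply]
  split_ifs <;> simp

variable {K : ℕ → ℝ} (hK : ∀ i v, ∑ w, G.distMatrix i v w = K i)
include hK

lemma sphereCard_zero : K 0 = 1 := by
  classical
  obtain ⟨v⟩ := h.connected.nonempty
  rw [← hK 0 v, h.connected.distMatrix_zero]
  simp [Matrix.one_apply]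

/-- The edges between two consecutive spheres around a vertex, counted from either side. -/
lemma b_mul_sphereCard (i : ℕ) : b i * K i = c (i + 1) * K (i + 1) := by
  obtain ⟨v⟩ := h.connected.nonempty
  have h1 : ∑ w, G.distMatrix i v w * (G.distMatrix (i + 1) * G.adjMatrix ℝ) v w = b i * K i := by
    rw [← hK i v, Finset.mul_sum]
    refine Finset.sum_congr rfl fun w _ => ?_
    rw [h.distMatrix_mul_adjMatrix_apply, distMatrix_apply]
    by_cases hw : G.dist v w = i <;> simp [hw, show i ≠ i + 1 + 1 by omega]
  have h2 : ∑ x, G.distMatrix (i + 1) v x * (G.distMatrix i * G.adjMatrix ℝ) v x =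
      c (i + 1) * K (i + 1) := by
    rw [← hK (i + 1) v, Finset.mul_sum]
    refine Finset.sum_congr rfl fun w _ => ?_
    rw [h.distMatrix_mul_adjMatrix_apply, distMatrix_apply]
    by_cases hw : G.dist v w = i + 1 <;> simp [hw, show i + 1 + 1 ≠ i by omega]
  rw [← h1, ← h2]
  simp only [Matrix.mul_apply, Finset.mul_sum]
  rw [Finset.sum_comm]
  refine Finset.sum_congr rfl fun x _ => Finset.sum_congr rfl fun w _ => ?_
  simp only [adjMatrix_apply, G.adj_comm x w]
  ring

/-! ### A bound for `a i` -/

/-- Moving a vertex `u` to a neighbour changes a proportion `1 - a i / b 0` of its sphere of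
radius `i`. Hence if `a i` is close to the degree, then two vertices at distance `t` have nearly the
same sphere of radius `i`. When the spheres of radius `t` are much larger than those of radius `i`,
this is impossible for most pairs at distance `t`, and so for all of them. -/
lemma mul_sphereCard_sub_le [Nonempty V] (i t : ℕ) (hi : 0 < K i) (hb : 0 < b 0) :
    (b 0 : ℝ) * (K t - K i) ≤ t * (b 0 - a i) * K t := by
  obtain ⟨u⟩ := ‹Nonempty V›
  set B := G.distMatrix i * G.distMatrix i with hB
  obtain ⟨g, hg⟩ : G.DependsOnDist B :=
    h.dependsOnDist_mul_distMatrix (dependsOnDist_distMatrix i) i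
  have hBself (v : V) : B v v = K i := by
    rw [hB, Matrix.mul_apply, ← hK i v]
    refine Finset.sum_congr rfl fun w _ => ?_
    rw [distMatrix_apply_comm i w v, distMatrix_apply]
    split_ifs <;> simp
  have hBrow : ∑ w, B u w = K i * K i := by
    simp only [hB, Matrix.mul_apply]
    rw [Finset.sum_comm]
    simp only [← Finset.mul_sum, hK, ← Finset.sum_mul]
  have hBnonneg (v w : V) : 0 ≤ B v w :=
    Finset.sum_nonneg fun x _ => mul_nonneg (distMatrix_nonneg ..) (distMatrix_nonneg ..)
  -- the average of `B u w` over the neighbours `w` of `u`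
  have hg1 : (b 0 : ℝ) * g 1 = a i * K i := by
    have h1 : (B * G.adjMatrix ℝ) u u = b 0 * g 1 := by
      rw [mul_adjMatrix_apply, ← h.isRegularOfDegree u, ← card_neighborFinset_eq_degree,
        ← nsmul_eq_mul, ← Finset.sum_const]
      refine Finset.sum_congr rfl fun w hw => ?_
      rw [hg, dist_eq_one_iff_adj.2 ((G.mem_neighborFinset _ _).1 hw)]
    rw [← h1, hB, Matrix.mul_assoc, Matrix.mul_apply, ← hK i u, Finset.mul_sum]
    refine Finset.sum_congr rfl fun y _ => ?_
    rw [h.distMatrix_mul_adjMatrix_apply, distMatrix_apply, dist_comm]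
    by_cases hy : G.dist y u = i <;> simp [hy]
  -- along a geodesic the spheres change by the same amount in each step
  have hpath (j : ℕ) (w : V) (hj : G.dist u w = j) : K i - j * (K i - g 1) ≤ B u w := by
    induction j generalizing w with
    | zero =>
      rw [h.connected.dist_eq_zero_iff] at hj
      subst hj
      simp [hBself]
    | succ j ih =>
      obtain ⟨x, hx, hx'⟩ := h.connected.exists_adj_dist_eq hj
      have h1 := ih x hx'
      have h2 : B x w = g 1 := by rw [hg, dist_eq_one_iff_adj.2 hx]
      have h3 : B u x + B x w ≤ B u w + K i := by
        rw [hB, ← hK i x, Matrix.mul_apply, Matrix.mul_apply, Matrix.mul_apply,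
          ← Finset.sum_add_distrib, ← Finset.sum_add_distrib]
        refine Finset.sum_le_sum fun y _ => ?_
        rw [distMatrix_apply_comm i y x]
        simp only [distMatrix_apply]
        split_ifs <;> norm_num
      push_cast
      linarith
  have hsum : K t * (K i - t * (K i - g 1)) ≤ K i * K i := by
    rw [← hBrow, ← hK t u, Finset.sum_mul]
    refine Finset.sum_le_sum fun w _ => ?_
    rw [distMatrix_apply]
    split_ifs with hw
    · rw [one_mul]
      exact hpath t w hw
    · rw [zero_mul]
      exact hBnonneg u w
  have hb' : (0 : ℝ) < b 0 := by exact_mod_cast hb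
  have h4 := mul_le_mul_of_nonneg_left hsum hb'.le
  have h5 : K i * (b 0 * (K t - K i)) ≤ K i * (t * (b 0 - a i) * K t) := by
    linear_combination h4 - K t * t * hg1
  exact le_of_mul_le_mul_left h5 hi

/-! ### The eigenvalue bound -/

/-- Around a vertex `v` where the absolute value of an eigenvector is maximal, its averages over
the spheres satisfy a three-term recurrence. If nearly all vertices are at distance `t` from `v`,
the average over that sphere is nearly zero. For an eigenvalue away from all `a i` with `i < t` the
recurrence, followed inwards, makes the average nearly zero on all smaller spheres and finally at
`v` itself. -/
lemma abs_eigenvalue_le {d t : ℕ} {δ : ℝ} (ht : 1 ≤ t) (htd : t ≤ d) {v₀ w₀ : V}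
    (hd : G.dist v₀ w₀ = d) (hδ : δ ≤ 1 / 2) (hδ' : (8 * d : ℝ) ^ d * δ < 1)
    (hdom : Fintype.card V - K t ≤ δ * K t) {f : V → ℝ} {θ : ℝ} (hf : f ≠ 0)
    (hsum : ∑ w, f w = 0) (hθ : G.adjMatrix ℝ *ᵥ f = θ • f) :
    |θ| ≤ b 0 * (1 - 1 / (4 * d)) := by
  have hne : Nonempty V := ⟨v₀⟩
  have hatt (i : ℕ) (hi : i ≤ d) : ∃ u w, G.dist u w = i := by
    obtain ⟨x, hx, -⟩ := h.connected.exists_dist_add_dist_eq (hi.trans hd.ge)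
    exact ⟨x, w₀, hx⟩
  have hKpos (i : ℕ) (hi : i ≤ d) : 0 < K i := by
    obtain ⟨u, w, huw⟩ := hatt i hi
    exact zero_lt_one.trans_le (one_le_sphereCard hK huw)
  have hbk (i : ℕ) (hi : i ≤ d) : (b i : ℝ) ≤ b 0 := by
    obtain ⟨u, w, rfl⟩ := hatt i hi
    exact_mod_cast h.b_le u w
  have hK0 := h.sphereCard_zero hK
  have hb0 : 0 < b 0 := by
    obtain ⟨u, w, huw⟩ := hatt 1 (ht.trans htd)
    exact h.degree_pos huw
  have hk : (0 : ℝ) < b 0 := by exact_mod_cast hb0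
  have hd1 : (1 : ℝ) ≤ d := by exact_mod_cast ht.trans htd
  have hKt := hKpos t htd
  have hKsmall (i : ℕ) (hi : i ≠ t) : K i ≤ δ * K t := by
    have := sum_sphereCard_le hK {i, t}
    rw [Finset.sum_pair hi] at this
    linarith
  have hδ0 : 0 ≤ δ := by
    have h1 := hKsmall 0 (by omega)
    have h2 : 0 < δ * K t := lt_of_lt_of_le (by rw [hK0]; norm_num) h1
    exact (pos_of_mul_pos_left h2 hKt.le).le
  have hc (i : ℕ) (hi : i ≤ t) : (c i : ℝ) ≤ δ * b 0 := by
    obtain ⟨u, w, huw⟩ := hatt t htd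
    have h1 : (c i : ℝ) ≤ c t := by exact_mod_cast huw ▸ h.c_le (huw ▸ hi)
    refine h1.trans ?_
    obtain ⟨s, rfl⟩ : ∃ s, t = s + 1 := ⟨t - 1, by omega⟩
    have h2 := h.b_mul_sphereCard hK s
    have h3 : b s * K s ≤ b 0 * (δ * K (s + 1)) :=
      mul_le_mul (hbk s (by omega)) (hKsmall s (by omega)) (sphereCard_nonneg hK s) hk.le
    refine le_of_mul_le_mul_right ?_ hKt
    rw [← h2]
    linarith
  have ha (i : ℕ) (hi : i < t) : (a i : ℝ) ≤ b 0 * (1 - 1 / (2 * d)) := by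
    have h1 := h.mul_sphereCard_sub_le hK i t (hKpos i (by omega)) hb0
    have h2 := hKsmall i hi.ne
    have h3 : (b 0 : ℝ) * (1 / 2) * K t ≤ t * (b 0 - a i) * K t := by
      refine le_trans ?_ h1
      rw [mul_assoc]
      refine mul_le_mul_of_nonneg_left ?_ hk.le
      nlinarith
    have h4 := le_of_mul_le_mul_right h3 hKt
    have h5 : (t : ℝ) ≤ d := by exact_mod_cast htd
    have h6 : (0 : ℝ) < t := by exact_mod_cast ht
    have h7 : (0 : ℝ) ≤ b 0 - a i := by
      by_contra h8
      have := mul_neg_of_pos_of_neg h6 (not_le.1 h8)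
      linarith
    have h8 : (b 0 : ℝ) * (1 / 2) ≤ d * (b 0 - a i) := h4.trans (by gcongr)
    have h9 : (b 0 : ℝ) * (1 / (2 * d)) = b 0 * (1 / 2) / d := by field_simp
    have h10 : (b 0 : ℝ) * (1 / 2) / d ≤ b 0 - a i := by
      rw [div_le_iff₀ (by linarith)]
      linarith
    linarith
  obtain ⟨v, -, hv⟩ := Finset.exists_max_image univ (fun w => |f w|) ⟨v₀, mem_univ _⟩
  have hv' (w : V) : |f w| ≤ |f v| := hv w (mem_univ w)
  have hm : 0 < |f v| := by
    rw [abs_pos]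
    intro h0
    apply hf
    ext w
    simpa [h0] using hv' w
  set m := |f v|
  set S : ℕ → ℝ := fun i => (G.distMatrix i *ᵥ f) v with hS
  have hSle (i : ℕ) : |S i| ≤ K i * m := abs_distMatrix_mulVec_le hK hv' i v
  have hrec0 : θ * S 0 = c 1 * S 1 := by
    have h1 := congrFun (congrArg (fun M => M *ᵥ f) h.distMatrix_zero_mul_adjMatrix) v
    simpa [← Matrix.mulVec_mulVec, hθ, Matrix.mulVec_smul, Matrix.smul_mulVec] using h1
  have hrec (i : ℕ) : θ * S (i + 1) = b i * S i + a (i + 1) * S (i + 1) + c (i + 2) * S (i + 2) := by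
    have h1 := congrFun (congrArg (fun M => M *ᵥ f) (h.distMatrix_succ_mul_adjMatrix i)) v
    simpa [← Matrix.mulVec_mulVec, hθ, Matrix.mulVec_smul, Matrix.smul_mulVec,
      Matrix.add_mulVec] using h1
  by_contra! hbig
  have hgap (i : ℕ) (hi : i < t) : b 0 / (4 * d) ≤ |θ - a i| := by
    have h1 := ha i hi
    have h2 : (0 : ℝ) ≤ a i := Nat.cast_nonneg _
    have h3 : (b 0 : ℝ) * (1 / (2 * d)) = 2 * (b 0 / (4 * d)) := by field_simp; norm_num
    have h4 : (b 0 : ℝ) * (1 / (4 * d)) = b 0 / (4 * d) := by field_simp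
    have h5 : (b 0 : ℝ) / (4 * d) ≤ b 0 / 4 :=
      div_le_div_of_nonneg_left hk.le (by norm_num) (by linarith)
    rcases abs_cases θ with ⟨h6, -⟩ | ⟨h6, -⟩
    · exact le_trans (by linarith) (le_abs_self _)
    · exact le_trans (by linarith) (neg_le_abs _)
  have hstep (i : ℕ) (hi : i < t) (X : ℝ) (hX : |S (i + 1)| ≤ X * K (i + 1) * m) :
      |S i| ≤ 4 * d * (δ + X) * K i * m := by
    have hX0 : 0 ≤ X * m := by
      have h1 : 0 ≤ X * m * K (i + 1) := by linarith [abs_nonneg (S (i + 1))]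
      exact nonneg_of_mul_nonneg_left h1 (hKpos _ (by omega))
    have hout : |c (i + 1) * S (i + 1)| ≤ b 0 * X * K i * m := by
      rw [abs_mul, Nat.abs_cast]
      calc (c (i + 1) : ℝ) * |S (i + 1)| ≤ c (i + 1) * (X * K (i + 1) * m) := by gcongr
        _ = b i * (K i * (X * m)) := by linear_combination -(X * m) * h.b_mul_sphereCard hK i
        _ ≤ b 0 * (K i * (X * m)) :=
          mul_le_mul_of_nonneg_right (hbk i (by omega))
            (mul_nonneg (sphereCard_nonneg hK i) hX0)
        _ = _ := by ring
    have htot : |θ - a i| * |S i| ≤ b 0 * (δ + X) * K i * m := by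
      rw [← abs_mul]
      rcases i with _ | i
      · have h1 : (θ - a 0) * S 0 = c (0 + 1) * S (0 + 1) := by
          rw [h.a_zero, Nat.cast_zero, sub_zero, hrec0]
        rw [h1]
        have h2 : 0 ≤ b 0 * δ * K 0 * m := by rw [hK0]; positivity
        linarith
      · have h1 : (θ - a (i + 1)) * S (i + 1) =
            b i * S i + c (i + 1 + 1) * S (i + 1 + 1) := by linear_combination hrec i
        rw [h1]
        have hin : |b i * S i| ≤ b 0 * δ * K (i + 1) * m := by
          rw [abs_mul, Nat.abs_cast]
          calc (b i : ℝ) * |S i| ≤ b i * (K i * m) := by gcongr; exact hSle i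
            _ = c (i + 1) * (K (i + 1) * m) := by
              linear_combination m * h.b_mul_sphereCard hK i
            _ ≤ δ * b 0 * (K (i + 1) * m) :=
              mul_le_mul_of_nonneg_right (hc _ (by omega))
                (mul_nonneg (sphereCard_nonneg hK _) hm.le)
            _ = _ := by ring
        linarith [abs_add_le (b i * S i) (c (i + 1 + 1) * S (i + 1 + 1))]
    have h1 : (b 0 : ℝ) / (4 * d) * |S i| ≤ b 0 * (δ + X) * K i * m :=
      (mul_le_mul_of_nonneg_right (hgap i hi) (abs_nonneg _)).trans htot
    have h2 : (b 0 : ℝ) / (4 * d) * |S i| ≤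
        b 0 / (4 * d) * (4 * d * (δ + X) * K i * m) := by
      refine h1.trans_eq ?_
      field_simp
    exact le_of_mul_le_mul_left h2 (by positivity)
  have hall (j : ℕ) (hj : j ≤ t) : |S (t - j)| ≤ (8 * d) ^ j * δ * K (t - j) * m := by
    induction j with
    | zero =>
      have h1 := abs_distMatrix_mulVec_le_of_sum_eq_zero hK hv' hsum t v
      have h2 := mul_le_mul_of_nonneg_right hdom hm.le
      simpa using h1.trans h2
    | succ j ih =>
      have h1 := ih (by omega)
      rw [show t - j = t - (j + 1) + 1 by omega] at h1
      refine (hstep _ (by omega) _ h1).trans ?_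
      have h3 : (1 : ℝ) ≤ (8 * d) ^ j := one_le_pow₀ (by linarith)
      have h4 := sphereCard_nonneg hK (t - (j + 1))
      have h5 : 4 * d * (δ + (8 * d) ^ j * δ) ≤ (8 * d : ℝ) ^ (j + 1) * δ := by
        rw [pow_succ]
        nlinarith [mul_nonneg (mul_nonneg (by linarith : (0 : ℝ) ≤ d) hδ0) (sub_nonneg.2 h3)]
      gcongr
  have h1 := hall t le_rfl
  have h2 : S 0 = f v := by
    classical
    simp [hS, h.connected.distMatrix_zero]
  rw [Nat.sub_self, h2, hK0, mul_one] at h1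
  have h3 : (8 * d : ℝ) ^ t * δ ≤ (8 * d) ^ d * δ := by
    gcongr
    linarith
  have h4 : (8 * d : ℝ) ^ t * δ * m < 1 * m := by
    gcongr
    linarith
  exact absurd (h1.trans_lt h4) (by simp [m])

end HasIntersectionNumbers

/-! ### Dominant distances -/

omit [DecidableRel G.Adj] in
/-- A distance that is dominant among the pairs of vertices is dominant around each vertex: `K t` is
at least a proportion `1 - 2 ε` of the number of vertices. As `ε` may be small compared with the
reciprocal of that number, this uses that at least two vertices are not at distance `t` from a given
one. -/
lemma IsDominantDistance.card_sub_le {K : ℕ → ℝ} (hK : ∀ i v, ∑ w, G.distMatrix i v w = K i)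
    {ε : ℝ} {t : ℕ} (hdom : G.IsDominantDistance (1 - ε) t) (hG : G.Connected) {d : ℕ}
    (hd : 2 ≤ d) {v w : V} (hvw : G.dist v w = d) (hε : 0 < ε) :
    Fintype.card V - K t ≤ 2 * ε * Fintype.card V := by
  classical
  have hne : Nonempty V := ⟨v⟩
  obtain ⟨ht, hle⟩ := hdom
  have hedges : (2 : ℝ) * (G.distanceGraph t).edgeSet.ncard = Fintype.card V * K t := by
    have h1 := (G.distanceGraph t).sum_degrees_eq_twice_card_edges
    have h2 : (G.distanceGraph t).edgeSet.ncard = #(G.distanceGraph t).edgeFinset := by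
      rw [← coe_edgeFinset, Set.ncard_coe_finset]
    have h3 (u : V) : ((G.distanceGraph t).degree u : ℝ) = K t := by
      rw [sphereCard_eq_card hK t u, ← card_neighborFinset_eq_degree]
      congr 2
      ext x
      rw [mem_neighborFinset, Finset.mem_filter]
      simp only [Finset.mem_univ, true_and]
      refine ⟨fun hx => hx.2, fun h0 => ⟨?_, h0⟩⟩
      rintro rfl
      rw [dist_self] at h0
      omega
    rw [h2]
    have h4 : ((∑ u, (G.distanceGraph t).degree u : ℕ) : ℝ) = Fintype.card V * K t := by
      push_cast
      simp [h3]
    rw [← h4, h1]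
    push_cast
    ring
  have hcard : (0 : ℝ) < Fintype.card V := by exact_mod_cast Fintype.card_pos
  have h1 : (1 - ε) * (Fintype.card V - 1) ≤ K t := by
    rw [Nat.cast_choose_two] at hle
    refine le_of_mul_le_mul_left ?_ hcard
    linarith
  have h2 : K t + 2 ≤ Fintype.card V := by
    have hone (i : ℕ) (hi : i ≤ 2) : 1 ≤ K i := by
      obtain ⟨x, hx, -⟩ := hG.exists_dist_add_dist_eq ((hi.trans hd).trans hvw.ge)
      exact one_le_sphereCard hK hx
    obtain ⟨s, hs0, hs2, hst⟩ : ∃ s, 0 < s ∧ s ≤ 2 ∧ s ≠ t := by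
      by_cases h1 : t = 1
      · exact ⟨2, by omega⟩
      · exact ⟨1, by omega⟩
    have h3 := sum_sphereCard_le hK {0, s, t}
    rw [Finset.sum_insert (by simp; omega), Finset.sum_pair hst] at h3
    linarith [hone 0 (by omega), hone s hs2]
  linarith

lemma HasIntersectionNumbers.abs_adjEigenvalue_le [DecidableEq V] {a b c : ℕ → ℕ}
    (h : G.HasIntersectionNumbers a b c) {K : ℕ → ℝ}
    (hK : ∀ i v, ∑ w, G.distMatrix i v w = K i) {d t : ℕ} {δ : ℝ} (ht : 1 ≤ t) (htd : t ≤ d)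
    {v₀ w₀ : V} (hd : G.dist v₀ w₀ = d) (hδ : δ ≤ 1 / 2) (hδ' : (8 * d : ℝ) ^ d * δ < 1)
    (hdom : Fintype.card V - K t ≤ δ * K t) (i : Fin (Fintype.card V)) (hi : (i : ℕ) ≠ 0) :
    |G.adjEigenvalue i| ≤ b 0 * (1 - 1 / (4 * d)) := by
  refine (G.isHermitian_adjMatrix ℝ).abs_eigenvalues₀_le_of_sum_eq_zero (k := b 0) ?_ ?_
    (fun f θ hf hsum hθ => h.abs_eigenvalue_le hK ht htd hd hδ hδ' hdom hf hsum hθ) i hi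
  · have hb : (0 : ℝ) < b 0 := by
      obtain ⟨x, hx, -⟩ := h.connected.exists_dist_add_dist_eq ((ht.trans htd).trans hd.ge)
      exact_mod_cast h.degree_pos hx
    have hd0 : (0 : ℝ) < d := by exact_mod_cast ht.trans htd
    have : (0 : ℝ) < 1 / (4 * d) := by positivity
    nlinarith
  · ext v
    simp [adjMatrix_mulVec_apply, h.isRegularOfDegree v]

end SimpleGraph

/-- The first part of the conclusion is for a distance that is dominant among all pairs of distinct
vertices; the second part is the form of the result in terms of the distance degrees `k_t`. -/
theorem theorem1p1 (d : ℕ) (hd : 2 ≤ d) :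
    ∃ ε : ℝ, 0 < ε ∧ ∃ η : ℝ, 0 < η ∧
      ∀ (V : Type*) [Fintype V] [DecidableEq V] (G : SimpleGraph V) [DecidableRel G.Adj],
        G.IsDistanceRegular → G.diam = d →
          ((∃ t : ℕ, G.IsDominantDistance (1 - ε) t) → G.IsSpectralExpander η) ∧
          ((∃ t : ℕ, 1 ≤ t ∧ t ≤ d ∧
              ∀ v : V, (1 - ε) * (Fintype.card V : ℝ) ≤ ((G.distSphere t v).ncard : ℝ)) →
            ∃ k : ℕ, G.IsRegularOfDegree k ∧ G.zeroWeightSpectralRadius ≤ k * (1 - η)) := by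
  have hd0 : (2 : ℝ) ≤ d := by exact_mod_cast hd
  have hpow : (1 : ℝ) ≤ (8 * d) ^ d := one_le_pow₀ (by linarith)
  set ε : ℝ := 1 / (8 * (8 * d) ^ d) with hε
  have hε0 : 0 < ε := by positivity
  have hε8 : ε ≤ 1 / 8 := one_div_le_one_div_of_le (by norm_num) (by linarith)
  have hδ' : (8 * d : ℝ) ^ d * (4 * ε) < 1 := by
    rw [hε]
    field_simp
    norm_num
  refine ⟨ε, hε0, 1 / (4 * d), by positivity, fun V _ _ G _ hG hdiam => ?_⟩
  obtain ⟨a, b, c, h⟩ := hG.exists_hasIntersectionNumbers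
  obtain ⟨K, hK⟩ := h.exists_sphereCard
  have hne : Nonempty V := h.connected.nonempty
  obtain ⟨v₀, w₀, hvw⟩ := G.exists_dist_eq_diam
  rw [hdiam] at hvw
  have hcard : (0 : ℝ) < Fintype.card V := by exact_mod_cast Fintype.card_pos
  -- both notions of dominance provide this hypothesis
  have main (t : ℕ) (ht : 1 ≤ t) (hdom : Fintype.card V - K t ≤ 2 * ε * Fintype.card V) :
      ∀ i : Fin (Fintype.card V), (i : ℕ) ≠ 0 →
        |G.adjEigenvalue i| ≤ b 0 * (1 - 1 / (4 * d)) := by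
    have hKt : (Fintype.card V : ℝ) / 2 ≤ K t := by nlinarith
    have htd : t ≤ d := by
      by_contra! htd
      have h0 : K t = 0 := by
        rw [SimpleGraph.sphereCard_eq_card hK t v₀, Nat.cast_eq_zero,
          Finset.card_eq_zero, Finset.filter_eq_empty_iff]
        intro w _ hw
        have := SimpleGraph.dist_le_diam hG.2.1 (u := v₀) (v := w)
        omega
      linarith
    refine h.abs_adjEigenvalue_le hK ht htd hvw (δ := 4 * ε) (by linarith) hδ' ?_
    nlinarith
  refine ⟨fun ⟨t, ht⟩ => ⟨b 0, h.isRegularOfDegree, main t ht.1 ?_⟩, fun ⟨t, ht, _, hdom⟩ =>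
    ⟨b 0, h.isRegularOfDegree, ?_⟩⟩
  · exact ht.card_sub_le hK h.connected hd hvw hε0
  · have hsphere : ((G.distSphere t v₀).ncard : ℝ) = K t := by
      rw [SimpleGraph.sphereCard_eq_card hK t v₀, ← Set.ncard_coe_finset]
      congr 2
      ext w
      simp [SimpleGraph.distSphere]
    have hb : 0 ≤ (b 0 : ℝ) * (1 - 1 / (4 * d)) := by
      have : (1 : ℝ) / (4 * d) ≤ 1 := by
        rw [div_le_one (by positivity)]
        linarith
      exact mul_nonneg (Nat.cast_nonneg _) (by linarith)
    refine Real.iSup_le (fun i => main t ht ?_ i.1 i.2) hb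
    have := hdom v₀
    rw [hsphere] at this
    nlinarith
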